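/- All graphs are finite, simple and undirected. **Colour refinement.** Let $G$ be a graph with a vertex colouring $c$. The algorithm $1$-$\mathsf{WL}$ computes $\mathsf{WL}^0(x)=c(x)$ and $$\mathsf{WL}^{d+1}(x)=\Bigl(\mathsf{WL}^d(x),\ \{\!\{(\mathrm{atp}(x,y),\mathsf{WL}^d(y)) : y\in V(G)\}\!\}\Bigr),$$ where the atomic type $\mathrm{atp}(x,y)$ records whether $x=y$, whether $xy\in E(G)$, and the colours $c(x)$, $c(y)$. Two coloured graphs are $1$-$\mathsf{WL}$ indistinguishable if for every $d\ge 0$ their multisets of colours after $d$ rounds coincide. Two vertices (possibly of different coloured graphs) have the same stable colour if their colours after $d$ rounds coincide for every $d$. **Individualisation.** For $v\in V(G)$ let $G_v$ be the coloured graph obtained from $G$ by colouring $v$ orange and all other vertices grey, let $\mathcal C_G^v$ be the stable colouring computed by $1$-$\mathsf{WL}$ on $G_v$, and let $M^v=\sum_{C}|C|^{-1}\mathbf 1_C\mathbf 1_C^T$ be its averaging matrix, the sum being over the colour classes $C$ of $\mathcal C_G^v$. A bijection $\pi\colon V(G)\to V(H)$ is colour-preserving if $G_v$ and $H_{\pi(v)}$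 are $1$-$\mathsf{WL}$ indistinguishable for all $v\in V(G)$; $G$ and $H$ are $(1,1)$-$\mathsf{WL}$ indistinguishable if such a $\pi$ exists. **Equitable matrix maps.** A matrix map $\phi$ assigns to every graph $G$ a matrix $\phi(G)\in\mathbb C^{V(G)\times V(G)}$. It is equitable if for all $(1,1)$-$\mathsf{WL}$ indistinguishable graphs $G,H$ and all colour-preserving bijections $\pi\colon V(G)\to V(H)$: 1. $M^v\phi(G)=\phi(G)M^v$ for all $v\in V(G)$; 2. $P\phi(G)M^v=\phi(H)PM^v$ for all $v\in V(G)$ and all permutation transformations $P\colon\mathbb C^{V(G)}\to\mathbb C^{V(H)}$, $Pe_x=e_{\sigma(x)}$ with $\sigma\colon V(G)\to V(H)$ a bijection, such that $\mathcal C_G^v(x)=\mathcal C_H^{\pi(v)}(\sigma(x))$ for all $x\in V(G)$. **Commute distance.** The random walk on $G$ moves from a vertex to a uniformly random neighbour. For vertices $s,t$ of $G$ the hitting time $H(s,t)\in[0,\infty]$ is the expected value of the first time $n\ge 0$ at which the random walk started in $s$ is at $t$, and the commute distance is $\kappa_G(s,t)=H(s,t)+H(t,s)$. **Proposition.** Let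 $I,A,D,J$ denote the matrix maps that assign to a graph its identity, adjacency, degree and all-ones matrix, and let $m(G)=|E(G)|$. For a matrix map $\phi$ let $\phi^{-1}(G)$ be the inverse of $\phi(G)$ if $\phi(G)$ is non-singular and the zero matrix otherwise. Define $$K=\Bigl(I-D^{-1}A+\tfrac{1}{2m}JD\Bigr)^{-1}\bigl(2mD^{-1}-J\bigr),$$ where for an edgeless graph (for which $JD=0$) the term $\tfrac1{2m}JD$ is read as the zero matrix. Then $K$ is an equitable matrix map. Moreover, for every connected graph $G$ and all $s,t\in V(G)$, the commute distance $\kappa_G(s,t)$ is finite and $$\kappa_G(s,t)=(e_s-e_t)^T K(G)\,(e_s-e_t).$$ -/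

import Mathlib

open MeasureTheory ProbabilityTheory

universe u

namespace EquitableWL

noncomputable section

/-! ### One-dimensional Weisfeiler-Leman on vertex-coloured graphs -/

/-- The atomic type of a pair `(x, y)` of vertices of the coloured graph `(G, c)`: two pairs get
the same value iff mapping one to the other entrywise is a partial isomorphism. -/
def atp {V : Type u} {C : Type} (G : SimpleGraph V) (c : V → C) (x y : V) :
    Prop × Prop × C × C :=
  (x = y, G.Adj x y, c x, c y)

/-- The set of colours used by 1-WL after `d` rounds. -/
def WLColour (C : Type) : ℕ → Type
  | 0 => C
  | d + 1 => WLColour C d × Multiset ((Prop × Prop × C × C) × WLColour C d)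

/-- The colour of a vertex after `d` rounds of 1-WL on the coloured graph `(G, c)`. -/
def wl {V : Type u} [Fintype V] {C : Type} (G : SimpleGraph V) (c : V → C) :
    (d : ℕ) → V → WLColour C d
  | 0, x => c x
  | d + 1, x => (wl G c d x, Finset.univ.val.map fun y => (atp G c x y, wl G c d y))

/-- The stable 1-WL colour of a vertex, recorded as the sequence of its colours in all rounds.
Two vertices (possibly of different coloured graphs) have the same stable colour iff no round
of 1-WL separates them. -/
def stableColour {V : Type u} [Fintype V] {C : Type} (G : SimpleGraph V) (c : V → C) (x : V) :
    (d : ℕ) → WLColour C d :=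
  fun d => wl G c d x

/-- Two coloured graphs are 1-WL indistinguishable if the multisets of 1-WL colours of their
vertices agree after every number of rounds. -/
def WLIndistinguishable {V W : Type u} [Fintype V] [Fintype W] {C : Type}
    (G : SimpleGraph V) (c : V → C) (H : SimpleGraph W) (c' : W → C) : Prop :=
  ∀ d : ℕ, (Finset.univ : Finset V).val.map (wl G c d) =
    (Finset.univ : Finset W).val.map (wl H c' d)

/-! ### Vertex individualisation -/

/-- The two colours of a vertex-individualised graph. -/
inductive IndColour : Type
  | orange
  | grey

open Classical in
/-- The colouring of the vertex-individualised graph `G_v`: `v` is orange, the rest is grey. -/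
def individualise {V : Type u} (v : V) : V → IndColour :=
  fun x => if x = v then IndColour.orange else IndColour.grey

/-- The colouring `𝒞_G^v` obtained by running 1-WL on the vertex-individualised graph `G_v`. -/
def indStableColour {V : Type u} [Fintype V] (G : SimpleGraph V) (v : V) :
    V → ((d : ℕ) → WLColour IndColour d) :=
  stableColour G (individualise v)

/-- A bijection `π` is colour-preserving if `G_v` and `H_{π(v)}` are 1-WL indistinguishable
for all `v`. The graphs are (1,1)-WL indistinguishable iff such a bijection exists. -/
def ColourPreserving {V W : Type u} [Fintype V] [Fintype W]
    (G : SimpleGraph V) (H : SimpleGraph W) (π : V ≃ W) : Prop :=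
  ∀ v : V, WLIndistinguishable G (individualise v) H (individualise (π v))

/-! ### Equitable matrix maps -/

/-- A matrix map assigns to every finite simple graph `G` a complex `V(G) × V(G)` matrix. -/
def MatrixMap : Type (u + 1) :=
  ∀ (V : Type u) [Fintype V], SimpleGraph V → Matrix V V ℂ

open Classical in
/-- The averaging matrix `∑_C |C|⁻¹ 1_C 1_Cᵀ` of the colouring `c`, the sum being over the
colour classes: the `(x, y)` entry is `|C|⁻¹` if `x` and `y` lie in the same class `C`, and `0`
otherwise. -/
def averagingMatrix {V : Type u} [Fintype V] {C : Type} (c : V → C) : Matrix V V ℂ :=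
  Matrix.of fun x y =>
    if c x = c y then ((Finset.univ.filter fun z => c z = c x).card : ℂ)⁻¹ else 0

open Classical in
/-- The permutation transformation `P` with `P e_x = e_{σ x}` for all `x`. -/
def permTransformation {V W : Type u} (σ : V ≃ W) : Matrix W V ℂ :=
  Matrix.of fun y x => if σ x = y then 1 else 0

/-- Equitable matrix maps: for all (1,1)-WL indistinguishable `G`, `H` and all colour-preserving
`π`, the conditions (E1) `M^v φ(G) = φ(G) M^v` and (E2) `P φ(G) M^v = φ(H) P M^v` for every
permutation transformation `P` that maps the colouring `𝒞_G^v` to `𝒞_H^{π(v)}`. -/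
def IsEquitable (φ : MatrixMap.{u}) : Prop :=
  ∀ (V W : Type u) [Fintype V] [Fintype W] (G : SimpleGraph V) (H : SimpleGraph W) (π : V ≃ W),
    ColourPreserving G H π →
      (∀ v : V, averagingMatrix (indStableColour G v) * φ V G =
        φ V G * averagingMatrix (indStableColour G v)) ∧
      (∀ (v : V) (σ : V ≃ W),
        (∀ x : V, indStableColour G v x = indStableColour H (π v) (σ x)) →
          permTransformation σ * φ V G * averagingMatrix (indStableColour G v) =
            φ W H * permTransformation σ * averagingMatrix (indStableColour G v))

/-! ### The matrix map `K` -/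

open Classical in
/-- The adjacency matrix map `A`. -/
def adjacencyMap : MatrixMap.{u} := fun _ _ G => G.adjMatrix ℂ

open Classical in
/-- The degree matrix map `D`. -/
def degreeMap : MatrixMap.{u} := fun _ _ G => G.degMatrix ℂ

/-- The all-ones matrix map `J`. -/
def onesMap : MatrixMap.{u} := fun _ _ _ => Matrix.of fun _ _ => 1

open Classical in
/-- The identity matrix map `I`. -/
def identityMap : MatrixMap.{u} := fun _ _ _ => 1

open Classical in
/-- The inverse of a matrix map, the inverse of a singular matrix being the zero matrix. -/
def inverseMap (φ : MatrixMap.{u}) : MatrixMap.{u} :=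
  fun V _ G => if IsUnit (φ V G).det then (φ V G)⁻¹ else 0

open Classical in
/-- The number of edges `m` of a graph. -/
def numEdges {V : Type u} [Fintype V] (G : SimpleGraph V) : ℕ := G.edgeFinset.card

/-- The matrix map `I - D⁻¹ A + J D / (2m)`. For an edgeless graph, where `J D = 0`, the last
summand is the zero matrix. -/
def kBase : MatrixMap.{u} := fun V _ G =>
  identityMap V G - inverseMap degreeMap V G * adjacencyMap V G +
    (2 * (numEdges G : ℂ))⁻¹ • (onesMap V G * degreeMap V G)

/-- The matrix map `K = (I - D⁻¹ A + J D / (2m))⁻¹ (2m D⁻¹ - J)`. -/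
def kMap : MatrixMap.{u} := fun V _ G =>
  inverseMap kBase V G *
    ((2 * (numEdges G : ℂ)) • inverseMap degreeMap V G - onesMap V G)

/-! ### Random walks and commute distances -/

open Classical in
/-- One step of the random walk on `G` from `v`: a uniformly random neighbour of `v`
(the walk stays put at an isolated vertex). -/
def walkStep {V : Type u} [Fintype V] (G : SimpleGraph V) (v : V) : PMF V :=
  if h : (G.neighborFinset v).Nonempty then PMF.uniformOfFinset (G.neighborFinset v) h
  else PMF.pure v

/-- The law of the next position of the walk, given its positions at times `0, …, n`. -/
def walkKernel {V : Type u} [Fintype V] [MeasurableSpace V] [DiscreteMeasurableSpace V]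
    (G : SimpleGraph V) (n : ℕ) : Kernel ((_ : Finset.Iic n) → V) V where
  toFun x := (walkStep G (x ⟨n, Finset.mem_Iic.2 le_rfl⟩)).toMeasure
  measurable' := Measurable.of_discrete.comp
    (g := fun v : V => (walkStep G v).toMeasure) (measurable_pi_apply _)

instance {V : Type u} [Fintype V] [MeasurableSpace V] [DiscreteMeasurableSpace V]
    (G : SimpleGraph V) (n : ℕ) : IsMarkovKernel (walkKernel G n) :=
  ⟨fun _ => PMF.toMeasure.isProbabilityMeasure _⟩

/-- The law of the trajectory `(X_0, X_1, …)` of the random walk on `G` with `X_0 = s`. -/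
def walkLaw {V : Type u} [Fintype V] [MeasurableSpace V] [DiscreteMeasurableSpace V]
    (G : SimpleGraph V) (s : V) : Measure (ℕ → V) :=
  Kernel.traj (X := fun _ => V) (walkKernel G) 0 (fun _ => s)

/-- The first time `n ≥ 0` at which the trajectory `ω` is at `t` (`∞` if there is none). -/
def firstVisit {V : Type u} (t : V) (ω : ℕ → V) : ENNReal :=
  ⨅ (n : ℕ) (_ : ω n = t), (n : ENNReal)

/-- The hitting time: the expected duration of a random walk from `s` until it reaches `t`. -/
def hittingTime {V : Type u} [Fintype V] [MeasurableSpace V] [DiscreteMeasurableSpace V]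
    (G : SimpleGraph V) (s t : V) : ENNReal :=
  ∫⁻ ω, firstVisit t ω ∂(walkLaw G s)

/-- The commute distance `κ_G(s, t)`. -/
def commuteDistance {V : Type u} [Fintype V] [MeasurableSpace V] [DiscreteMeasurableSpace V]
    (G : SimpleGraph V) (s t : V) : ENNReal :=
  hittingTime G s t + hittingTime G t s

end

end EquitableWL

/-! Equitability: `I`, `A`, `D`, `J` are equitable because stable colours determine degrees and the
number of neighbours in each colour class. Equitable maps are closed under sums, products, scalars
depending only on `m`, and inverses, so `K` is equitable. The delicate case is inversion:
`IsEquitable.det_eq_zero` carries a kernel vector from `G` to `H`, so singularity occurs in both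
graphs or in neither.

Commute distance: fix `t` and let `h(x)` be the hitting time of `t` from `x`. It is finite because
the degree-weighted mass of surviving walks is finite and only leaks into `t`. First-step analysis
gives `(I - D⁻¹A)h = 1` off `t`; since the degree vector annihilates the image of `I - D⁻¹A`, the
value at `t` must be `1 - 2m/d_t`. Hence `B h = S·1 - (2m/d_t) e_t` for `B = kBase` and some scalar
`S`. As `B` is invertible and fixes `1`, `Z = B⁻¹` yields `h(s) = (2m/d_t)(Z_tt - Z_st)`
(`eq_of_first_step`). Adding the two directions gives the quadratic form of `K`. -/

namespace EquitableWL

/-! ### One step of the walk and first visits. -/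

open Classical in
theorem walkStep_apply {V : Type u} [Fintype V] (G : SimpleGraph V) {v : V} (hv : G.degree v ≠ 0)
    (u : V) : walkStep G v u = if G.Adj v u then (G.degree v : ENNReal)⁻¹ else 0 := by
  have h : (G.neighborFinset v).Nonempty := by
    rw [← Finset.card_pos, G.card_neighborFinset_eq_degree]; omega
  rw [walkStep, dif_pos (by convert h)]
  simp only [PMF.uniformOfFinset_apply, SimpleGraph.mem_neighborFinset]
  congr

open Classical in
theorem degree_mul_sum_walkStep {V : Type u} [Fintype V] (G : SimpleGraph V) {s : V} (hs : G.degree s ≠ 0)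
    (f : V → ENNReal) :
    (G.degree s : ENNReal) * ∑ u, walkStep G s u * f u = ∑ u, if G.Adj s u then f u else 0 := by
  rw [Finset.mul_sum]
  refine Finset.sum_congr rfl fun u _ => ?_
  rw [walkStep_apply G hs]
  split_ifs
  · rw [← mul_assoc, ENNReal.mul_inv_cancel (by exact_mod_cast hs) (by simp), one_mul]
  · simp

theorem neighborSet_nonempty_of_connected {V : Type u} {G : SimpleGraph V} (hG : G.Connected) {s t : V}
    (hst : s ≠ t) (v : V) : (G.neighborSet v).Nonempty := by
  have : Nontrivial V := ⟨s, t, hst⟩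
  obtain ⟨w, hw⟩ := hG.preconnected.exists_adj_of_nontrivial v
  exact ⟨w, hw⟩

-- Tail-sum formula: the nonzero terms are those with index below the first visit. If `t` is never
-- visited, every term is `1` and both sides are `∞`.
open Classical in
theorem firstVisit_eq_tsum {V : Type u} (t : V) (ω : ℕ → V) :
    firstVisit t ω = ∑' n : ℕ, if ∀ k ≤ n, ω k ≠ t then (1 : ENNReal) else 0 := by
  by_cases h : ∃ n, ω n = t
  · have h1 : ∀ n, (∀ k ≤ n, ω k ≠ t) ↔ n ∈ Finset.range (Nat.find h) := by
      intro n
      rw [Finset.mem_range, Nat.lt_find_iff]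
    simp only [h1, firstVisit]
    rw [tsum_eq_sum (s := Finset.range (Nat.find h)) (fun n hn => by simp [hn]),
      Finset.sum_ite_mem, Finset.inter_self, Finset.sum_const, Finset.card_range, nsmul_eq_mul,
      mul_one]
    refine le_antisymm (iInf₂_le (Nat.find h) (Nat.find_spec h)) (le_iInf₂ fun n hn => ?_)
    exact_mod_cast Nat.find_min' h hn
  · push Not at h
    simp [firstVisit, h]

/-! ### The law of the walk: survival masses, first-step equations and finiteness. -/

section Law

variable {V : Type u} [Fintype V] [MeasurableSpace V] [DiscreteMeasurableSpace V]

theorem lintegral_walkStep (G : SimpleGraph V) (v : V) (f : V → ENNReal) :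
    ∫⁻ x, f x ∂(walkStep G v).toMeasure = ∑ x, walkStep G v x * f x := by
  rw [lintegral_fintype]
  refine Finset.sum_congr rfl fun x _ => ?_
  rw [PMF.toMeasure_apply_singleton _ _ (.singleton x), mul_comm]

/-- The walk law integrates a function of the past times a function of the next position by
averaging the latter over one step of the walk. -/
theorem lintegral_walkLaw_succ (G : SimpleGraph V) (s : V) (n : ℕ)
    (g : ((_ : Finset.Iic n) → V) → ENNReal) (f : V → ENNReal) :
    ∫⁻ ω, g (Preorder.frestrictLe n ω) * f (ω (n + 1)) ∂(walkLaw G s) =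
      ∫⁻ ω, g (Preorder.frestrictLe n ω) * ∑ u, walkStep G (ω n) u * f u ∂(walkLaw G s) := by
  have hf : Measurable f := .of_discrete
  have hg : Measurable g := .of_discrete
  have key := Kernel.partialTraj_compProd_eq_map_traj (X := fun _ => V) (κ := walkKernel G)
    (Nat.zero_le n) (x₀ := fun _ => s)
  have h1 : ∫⁻ ω, g (Preorder.frestrictLe n ω) * f (ω (n + 1)) ∂(walkLaw G s) =
      ∫⁻ p, g p.1 * f p.2 ∂((walkLaw G s).map
        fun x : ℕ → V => (Preorder.frestrictLe (π := fun _ => V) n x, x (n + 1))) := by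
    rw [lintegral_map (by fun_prop) (by fun_prop)]
  rw [h1, walkLaw, ← key, Measure.lintegral_compProd (by fun_prop),
    ← Kernel.traj_map_frestrictLe_apply, lintegral_map .of_discrete (by fun_prop)]
  refine lintegral_congr fun ω => ?_
  rw [← lintegral_walkStep]
  exact lintegral_const_mul (μ := (walkStep G (ω n)).toMeasure) (g (Preorder.frestrictLe n ω)) hf

theorem map_walkLaw_zero (G : SimpleGraph V) (s : V) :
    (walkLaw G s).map (fun ω => ω 0) = Measure.dirac s := by
  have h : (fun ω : ℕ → V => ω 0) =
      (fun x : ((_ : Finset.Iic 0) → V) => x ⟨0, Finset.mem_Iic.2 le_rfl⟩) ∘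
        Preorder.frestrictLe (π := fun _ => V) 0 := rfl
  rw [h, ← Measure.map_map (by fun_prop) (by fun_prop), walkLaw,
    Kernel.traj_map_frestrictLe_apply, Kernel.partialTraj_self, Kernel.id_apply]
  exact Measure.map_dirac' (measurable_pi_apply _) _

open Classical in
/-- The expectation of `f (X_n)` on the event that the walk from `s` avoids `t` up to time `n`. -/
noncomputable def survival (G : SimpleGraph V) (t : V) (n : ℕ) (f : V → ENNReal) (s : V) :
    ENNReal :=
  ∫⁻ ω, (if ∀ k ≤ n, ω k ≠ t then 1 else 0) * f (ω n) ∂(walkLaw G s)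

open Classical in
theorem survival_zero (G : SimpleGraph V) (t : V) (f : V → ENNReal) (s : V) :
    survival G t 0 f s = if s = t then 0 else f s := by
  have h : survival G t 0 f s =
      ∫⁻ x, (if x = t then 0 else f x) ∂((walkLaw G s).map (fun ω => ω 0)) := by
    rw [lintegral_map .of_discrete (by fun_prop), survival]
    refine lintegral_congr fun ω => ?_
    by_cases h : ω 0 = t <;> simp [h]
  rw [h, map_walkLaw_zero, lintegral_dirac]

open Classical in
theorem survival_succ (G : SimpleGraph V) (t : V) (n : ℕ) (f : V → ENNReal) (s : V) :
    survival G t (n + 1) f s =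
      survival G t n (fun x => ∑ u, walkStep G x u * if u = t then 0 else f u) s := by
  have := lintegral_walkLaw_succ G s n
    (fun x => if ∀ k : Finset.Iic n, x k ≠ t then 1 else 0) (fun u => if u = t then 0 else f u)
  simp only [Preorder.frestrictLe_apply, Subtype.forall, Finset.mem_Iic] at this
  rw [survival, survival, ← this]
  refine lintegral_congr fun ω => ?_
  by_cases h : ω (n + 1) = t
  · have : ¬ ∀ k ≤ n + 1, ω k ≠ t := fun h' => h' _ le_rfl h
    simp [h, this]
  · have : (∀ k ≤ n + 1, ω k ≠ t) ↔ ∀ k ≤ n, ω k ≠ t := by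
      refine ⟨fun h' k hk => h' k (by omega), fun h' k hk => ?_⟩
      rcases Nat.lt_or_ge n k with hk' | hk'
      · rwa [show k = n + 1 by omega]
      · exact h' k hk'
    simp only [this, h, if_false]

-- The kernel description of the law peels off the last step. Induction with `f` varying turns this
-- into a recursion on the first step, with no need to shift trajectories.
open Classical in
theorem survival_first_step (G : SimpleGraph V) (t : V) (n : ℕ) (f : V → ENNReal) (s : V) :
    survival G t (n + 1) f s =
      if s = t then 0 else ∑ u, walkStep G s u * survival G t n f u := by
  induction n generalizing f with
  | zero => simp only [survival_succ, survival_zero]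
  | succ n ih => rw [survival_succ, ih]; simp only [survival_succ G t n f]

theorem survival_self (G : SimpleGraph V) (t : V) (n : ℕ) (f : V → ENNReal) :
    survival G t n f t = 0 := by
  cases n
  · simp [survival_zero]
  · simp [survival_first_step]

theorem hittingTime_eq_tsum (G : SimpleGraph V) (s t : V) :
    hittingTime G s t = ∑' n, survival G t n 1 s := by
  classical
  simp only [hittingTime, firstVisit_eq_tsum, survival, Pi.one_apply, mul_one]
  rw [lintegral_tsum]
  intro n
  refine (Measurable.ite ?_ measurable_const measurable_const).aemeasurable
  have : {ω : ℕ → V | ∀ k ≤ n, ω k ≠ t} = ⋂ k ∈ Set.Iic n, (fun ω => ω k) ⁻¹' {t}ᶜ := by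
    ext; simp
  rw [this]
  exact MeasurableSet.biInter (Set.to_countable _) fun k _ =>
    measurable_pi_apply k (MeasurableSet.singleton t).compl

theorem hittingTime_self (G : SimpleGraph V) (t : V) : hittingTime G t t = 0 := by
  simp [hittingTime_eq_tsum, survival_self]

/-- Splitting off the term `n = 0` of the tail sum. This holds in `[0, ∞]`, hence before finiteness
is known. -/
theorem hittingTime_of_ne (G : SimpleGraph V) {s t : V} (h : s ≠ t) :
    hittingTime G s t = 1 + ∑ u, walkStep G s u * hittingTime G u t := by
  simp only [hittingTime_eq_tsum]
  rw [tsum_eq_zero_add' ENNReal.summable, survival_zero, if_neg h, Pi.one_apply]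
  congr 1
  simp only [survival_first_step, if_neg h, ← ENNReal.tsum_mul_left]
  exact Summable.tsum_finsetSum fun _ _ => ENNReal.summable

open Classical in
/-- The degree-weighted mass of the surviving walks decreases by the flow into the target. -/
theorem sum_degree_mul_survival_succ (G : SimpleGraph V) (hG : ∀ v, G.degree v ≠ 0) (t : V)
    (n : ℕ) (f : V → ENNReal) :
    ∑ x, (G.degree x : ENNReal) * survival G t (n + 1) f x +
        ∑ u, (if G.Adj t u then survival G t n f u else 0) =
      ∑ x, (G.degree x : ENNReal) * survival G t n f x := by
  have h1 : ∀ x, (G.degree x : ENNReal) * survival G t (n + 1) f x +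
      (if x = t then ∑ u, (if G.Adj t u then survival G t n f u else 0) else 0) =
      ∑ u, if G.Adj x u then survival G t n f u else 0 := by
    intro x
    rw [survival_first_step]
    by_cases hx : x = t
    · simp [hx]
    · simp only [hx, if_false, add_zero]
      exact degree_mul_sum_walkStep G (hG x) _
  -- Symmetry of adjacency: the degree measure is reversible for the walk.
  have h2 : ∀ u, (G.degree u : ENNReal) * survival G t n f u =
      ∑ x, if G.Adj x u then survival G t n f u else 0 := by
    intro u
    rw [G.degree_eq_sum_if_adj, Finset.sum_mul]
    simp [G.adj_comm u]
  rw [Finset.sum_congr rfl fun u _ => h2 u, Finset.sum_comm, ← Finset.sum_congr rfl fun x _ => h1 x,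
    Finset.sum_add_distrib, Finset.sum_ite_eq' Finset.univ t]
  simp

/-- At each step the degree-weighted surviving mass drops by at least the survival mass at the
neighbour `u` of `t`. Telescoping bounds the tail sum at `u` by the finite initial mass. -/
theorem hittingTime_ne_top_of_adj (G : SimpleGraph V) {t u : V}
    (hG : ∀ v, (G.neighborSet v).Nonempty) (h : G.Adj t u) : hittingTime G u t ≠ ⊤ := by
  classical
  have hd : ∀ v, G.degree v ≠ 0 := fun v => by
    obtain ⟨w, hw⟩ := hG v
    exact (G.degree_pos_iff_exists_adj v).2 ⟨w, hw⟩ |>.ne'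
  have key : ∀ N, ∑ n ∈ Finset.range N, survival G t n 1 u +
      ∑ x, (G.degree x : ENNReal) * survival G t N 1 x ≤
        ∑ x, (G.degree x : ENNReal) * survival G t 0 1 x := by
    intro N
    induction N with
    | zero => simp
    | succ N ih =>
      refine le_trans ?_ ih
      rw [Finset.sum_range_succ, add_assoc, ← sum_degree_mul_survival_succ G hd t N]
      gcongr 1
      rw [add_comm]
      gcongr 1
      have := Finset.single_le_sum (f := fun u => if G.Adj t u then survival G t N 1 u else 0)
        (fun _ _ => zero_le) (Finset.mem_univ u)
      simpa [h] using this
  have hfin : ∑ x, (G.degree x : ENNReal) * survival G t 0 1 x ≠ ⊤ := by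
    refine ENNReal.sum_ne_top.2 fun x _ => ENNReal.mul_ne_top (by simp) ?_
    rw [survival_zero]
    split_ifs <;> simp
  rw [hittingTime_eq_tsum]
  refine ne_top_of_le_ne_top hfin ?_
  rw [ENNReal.tsum_eq_iSup_nat]
  exact iSup_le fun N => le_self_add.trans (key N)

theorem hittingTime_ne_top {G : SimpleGraph V} (hG : G.Connected) (s t : V) :
    hittingTime G s t ≠ ⊤ := by
  classical
  by_cases hst : s = t
  · simp [hst, hittingTime_self]
  have hne := neighborSet_nonempty_of_connected hG hst
  obtain ⟨w⟩ := hG t s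
  -- For `a ≠ t` the first-step equation gives the neighbour `b` positive weight, so an infinite
  -- value at `b` would force one at `a`.
  have step : ∀ {a b : V}, G.Adj a b → hittingTime G a t ≠ ⊤ → hittingTime G b t ≠ ⊤ := by
    intro a b hab ha
    by_cases hat : a = t
    · exact hittingTime_ne_top_of_adj G hne (hat ▸ hab)
    have hd : G.degree a ≠ 0 := ((G.degree_pos_iff_exists_adj a).2 ⟨b, hab⟩).ne'
    intro hb
    apply ha
    rw [hittingTime_of_ne G hat, ENNReal.add_eq_top]
    right
    refine ENNReal.sum_eq_top.2 ⟨b, Finset.mem_univ _, ?_⟩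
    rw [walkStep_apply G hd, if_pos hab, hb, ENNReal.mul_top (by simp)]
  have walk : ∀ {a b : V}, G.Walk a b → hittingTime G a t ≠ ⊤ → hittingTime G b t ≠ ⊤ := by
    intro a b p
    induction p with
    | nil => exact id
    | cons h _ ih => exact fun ha => ih (step h ha)
  exact walk w (by simp [hittingTime_self])

open Classical in
/-- The first-step equation for hitting times, multiplied by the degree. -/
theorem degree_mul_hittingTime {G : SimpleGraph V} (hG : G.Connected) {s t : V} (hst : s ≠ t) :
    (G.degree s : ℝ) * (hittingTime G s t).toReal =
      G.degree s + ∑ u, if G.Adj s u then (hittingTime G u t).toReal else 0 := by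
  have hd : G.degree s ≠ 0 := by
    obtain ⟨w, hw⟩ := neighborSet_nonempty_of_connected hG hst s
    exact ((G.degree_pos_iff_exists_adj s).2 ⟨w, hw⟩).ne'
  have h : (G.degree s : ENNReal) * hittingTime G s t =
      G.degree s + ∑ u, if G.Adj s u then hittingTime G u t else 0 := by
    rw [hittingTime_of_ne G hst, mul_add, mul_one, degree_mul_sum_walkStep G hd]
  have h' := congrArg ENNReal.toReal h
  have hfin : ∀ u, (if G.Adj s u then hittingTime G u t else 0) ≠ ⊤ := by
    intro u
    split_ifs
    · exact hittingTime_ne_top hG u t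
    · simp
  rw [ENNReal.toReal_mul, ENNReal.toReal_add (by simp) (ENNReal.sum_ne_top.2 fun u _ => hfin u),
    ENNReal.toReal_sum fun u _ => hfin u, ENNReal.toReal_natCast] at h'
  rw [h']
  congr 1
  refine Finset.sum_congr rfl fun u _ => ?_
  split_ifs <;> simp

end Law

/-! ### Linear algebra of `kBase` and its inverse. -/

section Algebra

open Matrix

variable {V : Type u} [Fintype V]

open Classical in
theorem sum_degree_eq (G : SimpleGraph V) : ∑ x, (G.degree x : ℂ) = 2 * (numEdges G : ℂ) := by
  have := G.sum_degrees_eq_twice_card_edges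
  rw [numEdges]
  exact_mod_cast this

open Classical in
theorem sum_sum_adj (G : SimpleGraph V) (f : V → ℂ) :
    ∑ x, ∑ u, (if G.Adj x u then f u else 0) = ∑ x, (G.degree x : ℂ) * f x := by
  rw [Finset.sum_comm]
  refine Finset.sum_congr rfl fun u _ => ?_
  rw [G.degree_eq_sum_if_adj, Finset.sum_mul]
  simp [G.adj_comm u]

open Classical in
theorem inverseMap_degreeMap {G : SimpleGraph V} (hd : ∀ v, (G.degree v : ℂ) ≠ 0) :
    inverseMap degreeMap V G = diagonal fun v => (G.degree v : ℂ)⁻¹ := by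
  have h : degreeMap V G = diagonal fun v => (G.degree v : ℂ) := by
    rw [degreeMap, SimpleGraph.degMatrix]
  have hu : IsUnit (degreeMap V G).det := by
    rw [h, det_diagonal, isUnit_iff_ne_zero]
    exact Finset.prod_ne_zero_iff.2 fun v _ => hd v
  rw [inverseMap, if_pos hu]
  refine inv_eq_left_inv ?_
  rw [h, diagonal_mul_diagonal, ← diagonal_one]
  congr 1
  ext v
  exact inv_mul_cancel₀ (hd v)

open Classical in
theorem kBase_mulVec_apply {G : SimpleGraph V} (hd : ∀ v, (G.degree v : ℂ) ≠ 0) (f : V → ℂ)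
    (x : V) : (kBase V G *ᵥ f) x =
      f x - (G.degree x : ℂ)⁻¹ * (∑ u, if G.Adj x u then f u else 0) +
        (2 * (numEdges G : ℂ))⁻¹ * ∑ u, (G.degree u : ℂ) * f u := by
  rw [kBase, inverseMap_degreeMap hd, add_mulVec, sub_mulVec, smul_mulVec, ← mulVec_mulVec,
    ← mulVec_mulVec]
  simp only [Pi.add_apply, Pi.sub_apply, Pi.smul_apply, mulVec_diagonal, smul_eq_mul, identityMap,
    one_mulVec, adjacencyMap, SimpleGraph.adjMatrix_mulVec_apply]
  congr 2
  · rw [← Finset.sum_filter]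
    congr 2
    ext
    simp
  · simp [mulVec, dotProduct, onesMap, degreeMap, SimpleGraph.degMatrix, diagonal_apply]

theorem numEdges_ne_zero {G : SimpleGraph V} {s t : V} (h : G.Adj s t) : (numEdges G : ℂ) ≠ 0 := by
  classical
  rw [numEdges, Nat.cast_ne_zero, ← Nat.pos_iff_ne_zero, Finset.card_pos]
  exact ⟨s(s, t), by simpa using h⟩

-- Stationarity: the degree vector is a left null vector of `I - D⁻¹A`.
open Classical in
theorem sum_degree_mul_sub (G : SimpleGraph V) (hd : ∀ v, (G.degree v : ℂ) ≠ 0) (f : V → ℂ) :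
    ∑ x, (G.degree x : ℂ) *
      (f x - (G.degree x : ℂ)⁻¹ * (∑ u, if G.Adj x u then f u else 0)) = 0 := by
  simp only [mul_sub, mul_inv_cancel_left₀ (hd _), Finset.sum_sub_distrib, sum_sum_adj, sub_self]

-- Harmonic functions on a connected graph are constant. The Laplacian kernel criterion is applied
-- over `ℝ`, to real and imaginary parts.
open Classical in
theorem eq_of_degree_mul_eq_sum_adj {G : SimpleGraph V} (hG : G.Connected) {f : V → ℂ}
    (hf : ∀ x, (G.degree x : ℂ) * f x = ∑ u, if G.Adj x u then f u else 0) (s t : V) :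
    f s = f t := by
  have key : ∀ g : ℂ →ₗ[ℝ] ℝ, g (f s) = g (f t) := by
    intro g
    refine (G.lapMatrix_mulVec_eq_zero_iff_forall_reachable (x := fun v => g (f v))).1 ?_ s t
      (hG s t)
    ext x
    rw [SimpleGraph.lapMatrix_mulVec_apply, Pi.zero_apply, sub_eq_zero]
    have h := congrArg g (hf x)
    rw [← nsmul_eq_mul, map_nsmul, map_sum, nsmul_eq_mul] at h
    rw [h, SimpleGraph.neighborFinset_eq_filter, Finset.sum_filter]
    refine Finset.sum_congr rfl fun u _ => ?_
    split_ifs <;> simp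
  exact Complex.ext (key Complex.reLm) (key Complex.imLm)

open Classical in
theorem degree_ne_zero_of_connected {G : SimpleGraph V} (hG : G.Connected) {s t : V} (hst : s ≠ t)
    (v : V) : (G.degree v : ℂ) ≠ 0 := by
  obtain ⟨w, hw⟩ := neighborSet_nonempty_of_connected hG hst v
  exact_mod_cast ((G.degree_pos_iff_exists_adj v).2 ⟨w, hw⟩).ne'

theorem numEdges_ne_zero_of_connected {G : SimpleGraph V} (hG : G.Connected) {s t : V}
    (hst : s ≠ t) : (2 * (numEdges G : ℂ)) ≠ 0 := by
  obtain ⟨w, hw⟩ := neighborSet_nonempty_of_connected hG hst s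
  exact mul_ne_zero two_ne_zero (numEdges_ne_zero hw)

-- Pairing a kernel vector `f` with the degrees leaves `∑ d f = 0`. Then `f` is harmonic, hence
-- constant, hence zero because `∑ d = 2m ≠ 0`. Two distinct vertices are needed: on a single vertex
-- `D` is singular and `m = 0`.
open Classical in
theorem isUnit_det_kBase {G : SimpleGraph V} (hG : G.Connected) {s t : V} (hst : s ≠ t) :
    IsUnit (kBase V G).det := by
  have hd := degree_ne_zero_of_connected hG hst
  have hm := numEdges_ne_zero_of_connected hG hst
  rw [isUnit_iff_ne_zero]
  intro h0
  obtain ⟨f, hf0, hf⟩ := exists_mulVec_eq_zero_iff.2 h0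
  have hf' := fun x => (kBase_mulVec_apply hd f x).symm.trans (congrFun hf x)
  have hpi : ∑ u, (G.degree u : ℂ) * f u = 0 := by
    have h := Finset.sum_congr rfl fun x (_ : x ∈ Finset.univ) =>
      congrArg ((G.degree x : ℂ) * ·) (hf' x)
    simp only [mul_add, Finset.sum_add_distrib, Pi.zero_apply, mul_zero, Finset.sum_const_zero,
      sum_degree_mul_sub G hd, zero_add] at h
    rwa [← Finset.sum_mul, sum_degree_eq, mul_inv_cancel_left₀ hm] at h
  have hconst := eq_of_degree_mul_eq_sum_adj hG (f := f) fun x => by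
    have h := hf' x
    rw [hpi, mul_zero, add_zero, Pi.zero_apply, sub_eq_zero] at h
    rw [h, mul_inv_cancel_left₀ (hd x)]
  apply hf0
  ext x
  rw [Finset.sum_congr rfl fun u _ => by rw [hconst u x], ← Finset.sum_mul, sum_degree_eq] at hpi
  exact (mul_eq_zero.1 hpi).resolve_left hm

theorem kBase_mulVec_one {G : SimpleGraph V} (hG : G.Connected) {s t : V} (hst : s ≠ t) :
    kBase V G *ᵥ 1 = 1 := by
  classical
  have hd := degree_ne_zero_of_connected hG hst
  ext x
  rw [kBase_mulVec_apply hd]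
  simp only [Pi.one_apply, mul_one, sum_degree_eq, ← G.degree_eq_sum_if_adj]
  rw [inv_mul_cancel₀ (hd x), inv_mul_cancel₀ (numEdges_ne_zero_of_connected hG hst)]
  ring

open Classical in
theorem inverseMap_mulVec {φ : MatrixMap.{u}} {G : SimpleGraph V} (h : IsUnit (φ V G).det)
    (f : V → ℂ) : inverseMap φ V G *ᵥ (φ V G *ᵥ f) = f := by
  rw [inverseMap, if_pos h, mulVec_mulVec, nonsing_inv_mul _ h, one_mulVec]

theorem inverseMap_kBase_mulVec_one {G : SimpleGraph V} (hG : G.Connected) {s t : V}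
    (hst : s ≠ t) : inverseMap kBase V G *ᵥ 1 = 1 := by
  conv_lhs => rw [← kBase_mulVec_one hG hst]
  exact inverseMap_mulVec (isUnit_det_kBase hG hst) 1

open Classical in
theorem kMap_apply {G : SimpleGraph V} (hG : G.Connected) {s t : V} (hst : s ≠ t) (x y : V) :
    kMap V G x y =
      inverseMap kBase V G x y * (2 * (numEdges G : ℂ) * (G.degree y : ℂ)⁻¹) - 1 := by
  have h2 := congrFun (inverseMap_kBase_mulVec_one hG hst) x
  simp only [mulVec, dotProduct, Pi.one_apply, mul_one] at h2
  rw [kMap, inverseMap_degreeMap (degree_ne_zero_of_connected hG hst), Matrix.mul_sub,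
    Matrix.sub_apply, Matrix.mul_smul, Matrix.smul_apply, mul_diagonal, smul_eq_mul]
  -- The rows of the inverse of `kBase` sum to `1`, so the `J` term contributes exactly `-1`.
  congr 1
  · ring
  · simp [Matrix.mul_apply, onesMap, h2]

open Classical in
/-- A function that vanishes at `t` and solves the first-step equations off `t` is given by the
inverse of `kBase`. -/
theorem eq_of_first_step {G : SimpleGraph V} (hG : G.Connected) {s t : V} (hst : s ≠ t)
    {h : V → ℂ} (ht : h t = 0)
    (hh : ∀ x, x ≠ t → (G.degree x : ℂ) * h x = G.degree x + ∑ u, if G.Adj x u then h u else 0) :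
    h s = 2 * (numEdges G : ℂ) * (G.degree t : ℂ)⁻¹ *
      (inverseMap kBase V G t t - inverseMap kBase V G s t) := by
  have hd := degree_ne_zero_of_connected hG hst
  set L : V → ℂ := fun x => h x - (G.degree x : ℂ)⁻¹ * (∑ u, if G.Adj x u then h u else 0) with hL
  have hL1 : ∀ x, x ≠ t → L x = 1 := by
    intro x hx
    have := hh x hx
    have hdx := hd x
    rw [hL]
    field_simp
    linear_combination this
  -- Forced by `∑ d L = 0`, since `L = 1` elsewhere and `∑ d = 2m`.
  have hLt : L t = 1 - 2 * (numEdges G : ℂ) * (G.degree t : ℂ)⁻¹ := by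
    have h0 : ∑ x, (G.degree x : ℂ) * L x = 0 := sum_degree_mul_sub G hd h
    have h1 : ∀ x, (G.degree x : ℂ) * L x =
        G.degree x + if x = t then (G.degree t : ℂ) * (L t - 1) else 0 := by
      intro x
      by_cases hx : x = t
      · subst hx; simp; ring
      · simp [hx, hL1 x hx]
    rw [Finset.sum_congr rfl fun x _ => h1 x, Finset.sum_add_distrib, sum_degree_eq,
      Finset.sum_ite_eq' Finset.univ t, if_pos (Finset.mem_univ t)] at h0
    have hdt := hd t
    field_simp
    linear_combination h0
  -- The value of `S` is irrelevant: the inverse fixes `1`, so `S` cancels in `h s - h t`.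
  obtain ⟨S, hS⟩ : ∃ S : ℂ, kBase V G *ᵥ h =
      S • 1 - (2 * (numEdges G : ℂ) * (G.degree t : ℂ)⁻¹) • Pi.single t 1 := by
    refine ⟨1 + (2 * (numEdges G : ℂ))⁻¹ * ∑ u, (G.degree u : ℂ) * h u, ?_⟩
    ext x
    have : (kBase V G *ᵥ h) x = L x + (2 * (numEdges G : ℂ))⁻¹ * ∑ u, (G.degree u : ℂ) * h u :=
      kBase_mulVec_apply hd h x
    rw [this]
    by_cases hx : x = t
    · subst hx; simp [hLt]; ring
    · simp [hx, hL1 x hx]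
  have hZ := congrArg (inverseMap kBase V G *ᵥ ·) hS
  simp only [inverseMap_mulVec (isUnit_det_kBase hG hst), mulVec_sub, mulVec_smul,
    inverseMap_kBase_mulVec_one hG hst] at hZ
  have hs := congrFun hZ s
  have ht' := congrFun hZ t
  simp only [Pi.sub_apply, Pi.smul_apply, mulVec_single_one, Matrix.col_apply, Pi.one_apply,
    smul_eq_mul] at hs ht'
  linear_combination hs - ht' + ht

end Algebra

/-! ### The commute distance as a quadratic form. -/

section Commute

open Matrix

variable {V : Type u} [Fintype V] [MeasurableSpace V] [DiscreteMeasurableSpace V]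

open Classical in
theorem hittingTime_eq {G : SimpleGraph V} (hG : G.Connected) {s t : V} (hst : s ≠ t) :
    ((hittingTime G s t).toReal : ℂ) = 2 * (numEdges G : ℂ) * (G.degree t : ℂ)⁻¹ *
      (inverseMap kBase V G t t - inverseMap kBase V G s t) := by
  refine eq_of_first_step hG hst (h := fun x => ((hittingTime G x t).toReal : ℂ))
    (by simp [hittingTime_self]) fun x hx => ?_
  have := congrArg (fun r : ℝ => (r : ℂ)) (degree_mul_hittingTime hG hx)
  push_cast at this
  rw [this]
  congr 1
  refine Finset.sum_congr rfl fun u _ => ?_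
  split_ifs <;> simp

theorem commuteDistance_ne_top {G : SimpleGraph V} (hG : G.Connected) (s t : V) :
    commuteDistance G s t ≠ ⊤ :=
  ENNReal.add_ne_top.2 ⟨hittingTime_ne_top hG s t, hittingTime_ne_top hG t s⟩

theorem commuteDistance_eq [DecidableEq V] {G : SimpleGraph V} (hG : G.Connected) (s t : V) :
    ((commuteDistance G s t).toReal : ℂ) =
      (Pi.single s 1 - Pi.single t 1 : V → ℂ) ⬝ᵥ
        (kMap V G *ᵥ (Pi.single s 1 - Pi.single t 1)) := by
  -- This case also covers the one-vertex graph, where the formulas for the inverses are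
  -- unavailable.
  by_cases hst : s = t
  · simp [hst, commuteDistance, hittingTime_self]
  rw [commuteDistance, ENNReal.toReal_add (hittingTime_ne_top hG s t) (hittingTime_ne_top hG t s),
    Complex.ofReal_add, hittingTime_eq hG hst, hittingTime_eq hG (Ne.symm hst)]
  simp only [mulVec_sub, sub_dotProduct, dotProduct_sub, mulVec_single_one, single_one_dotProduct,
    Matrix.col_apply, kMap_apply hG hst]
  ring

end Commute

/-! ### Stable colourings across two graphs. -/

section WeisfeilerLeman

variable {V W : Type u} [Fintype V] [Fintype W] {C : Type}

theorem wl_eq_of_le {G : SimpleGraph V} {c : V → C} {H : SimpleGraph W} {c' : W → C} {x : V}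
    {y : W} {d e : ℕ} (hde : d ≤ e) (h : wl G c e x = wl H c' e y) :
    wl G c d x = wl H c' d y := by
  induction e, hde using Nat.le_induction with
  | base => exact h
  | succ e _ ih => exact ih (congrArg Prod.fst h)

/-- Some number of rounds separates all vertices of `G` and `H` with different stable colours. -/
theorem exists_separating_round (G : SimpleGraph V) (c : V → C) (H : SimpleGraph W) (c' : W → C) :
    ∃ d, ∀ e, d ≤ e → ∀ x y, wl G c e x = wl H c' e y → stableColour G c x = stableColour H c' y := by
  classical
  have h : ∀ p : V × W, ∃ d, wl G c d p.1 = wl H c' d p.2 →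
      stableColour G c p.1 = stableColour H c' p.2 := by
    intro p
    by_contra! hp
    exact (hp 0).2 (funext fun d => (hp d).1)
  choose d hd using h
  refine ⟨Finset.univ.sup d, fun e he x y hxy => hd (x, y) (wl_eq_of_le ?_ hxy)⟩
  exact (Finset.le_sup (Finset.mem_univ _)).trans he

-- At a separating round, indistinguishability equates the sizes of corresponding colour classes;
-- `σ` glues bijections between them.
open Classical in
theorem exists_equiv_stableColour {G : SimpleGraph V} {c : V → C} {H : SimpleGraph W} {c' : W → C}
    (h : WLIndistinguishable G c H c') :
    ∃ σ : V ≃ W, ∀ x, stableColour G c x = stableColour H c' (σ x) := by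
  obtain ⟨d, hd⟩ := exists_separating_round G c H c'
  have hcard : ∀ k, Fintype.card {x // wl G c d x = k} = Fintype.card {y // wl H c' d y = k} := by
    intro k
    have := congrArg (Multiset.count k) (h d)
    simpa [Multiset.count_map, Fintype.card_subtype, Finset.card_def, eq_comm] using this
  refine ⟨Equiv.ofFiberEquiv (f := wl G c d) (g := wl H c' d)
    fun k => Fintype.equivOfCardEq (hcard k), fun x => hd d le_rfl x _ ?_⟩
  exact (Equiv.ofFiberEquiv_map _ x).symm

theorem map_atp_eq_of_stableColour_eq {G : SimpleGraph V} {c : V → C} {H : SimpleGraph W}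
    {c' : W → C} {x : V} {y : W} (h : stableColour G c x = stableColour H c' y) (d : ℕ) :
    Finset.univ.val.map (fun u => (atp G c x u, wl G c d u)) =
      Finset.univ.val.map fun u => (atp H c' y u, wl H c' d u) :=
  congrArg Prod.snd (congrFun h (d + 1))

open Classical in
theorem degree_eq_of_stableColour_eq {G : SimpleGraph V} {c : V → C} {H : SimpleGraph W}
    {c' : W → C} {x : V} {y : W} (h : stableColour G c x = stableColour H c' y) :
    G.degree x = H.degree y := by
  have h1 := congrArg (Multiset.countP fun p => p.1.2.1) (map_atp_eq_of_stableColour_eq h 0)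
  simp only [Multiset.countP_map, atp] at h1
  simpa [← SimpleGraph.card_neighborFinset_eq_degree, SimpleGraph.neighborFinset_eq_filter,
    Finset.card_def] using h1

open Classical in
/-- Stable colourings are equitable, across two graphs. -/
theorem card_adj_stableColour {G : SimpleGraph V} {c : V → C} {H : SimpleGraph W}
    {c' : W → C} {x : V} {y : W} (h : stableColour G c x = stableColour H c' y) (z : V) :
    (Finset.univ.filter fun u => G.Adj x u ∧ stableColour G c u = stableColour G c z).card =
      (Finset.univ.filter fun u => H.Adj y u ∧ stableColour H c' u = stableColour G c z).card := by
  obtain ⟨d₁, h₁⟩ := exists_separating_round G c G c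
  obtain ⟨d₂, h₂⟩ := exists_separating_round H c' G c
  -- At this round, having the colour of `z` already means having its stable colour, in both graphs,
  -- so the multiset of round `d + 1` counts neighbours by stable class.
  set d := max d₁ d₂
  have e₁ : ∀ u, wl G c d u = wl G c d z ↔ stableColour G c u = stableColour G c z := fun u =>
    ⟨h₁ d (le_max_left _ _) u z, fun h => congrFun h d⟩
  have e₂ : ∀ u, wl H c' d u = wl G c d z ↔ stableColour H c' u = stableColour G c z := fun u =>
    ⟨h₂ d (le_max_right _ _) u z, fun h => congrFun h d⟩
  have h1 := congrArg (Multiset.countP fun p => p.1.2.1 ∧ p.2 = wl G c d z)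
    (map_atp_eq_of_stableColour_eq h d)
  simp only [Multiset.countP_map, atp, e₁, e₂] at h1
  exact h1

/-- Round `0` already isolates the only orange vertex. -/
theorem indStableColour_eq_self_iff (G : SimpleGraph V) (v x : V) :
    indStableColour G v v = indStableColour G v x ↔ v = x := by
  refine ⟨fun h => ?_, fun h => h ▸ rfl⟩
  have h0 : individualise v v = individualise v x := congrFun h 0
  by_contra hne
  simp [individualise, Ne.symm hne] at h0

theorem ColourPreserving.symm {G : SimpleGraph V} {H : SimpleGraph W} {π : V ≃ W}
    (h : ColourPreserving G H π) : ColourPreserving H G π.symm := fun w d => by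
  simpa using (h (π.symm w) d).symm

theorem ColourPreserving.exists_equiv {G : SimpleGraph V} {H : SimpleGraph W} {π : V ≃ W}
    (h : ColourPreserving G H π) (v : V) :
    ∃ σ : V ≃ W, ∀ x, indStableColour G v x = indStableColour H (π v) (σ x) :=
  exists_equiv_stableColour (h v)

theorem numEdges_eq_of_stableColour_eq {G : SimpleGraph V} {c : V → C} {H : SimpleGraph W}
    {c' : W → C} (σ : V ≃ W) (h : ∀ x, stableColour G c x = stableColour H c' (σ x)) :
    numEdges G = numEdges H := by
  classical
  have hG := G.sum_degrees_eq_twice_card_edges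
  have hH := H.sum_degrees_eq_twice_card_edges
  rw [← Equiv.sum_comp σ, ← Finset.sum_congr rfl fun x _ => degree_eq_of_stableColour_eq (h x),
    hG] at hH
  simp only [numEdges]
  convert Nat.eq_of_mul_eq_mul_left two_pos hH

end WeisfeilerLeman

/-! ### Averaging matrices and permutation transformations. -/

section Matrices

open Matrix

variable {V W : Type u} [Fintype V] [Fintype W] {C : Type}

theorem averagingMatrix_transpose (c : V → C) : (averagingMatrix c)ᵀ = averagingMatrix c := by
  classical
  ext x y
  simp only [averagingMatrix, transpose_apply, of_apply, eq_comm (a := c y)]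
  split_ifs with h
  · simp [h]
  · rfl

theorem averagingMatrix_mul_of_const {c : V → C} {B : Matrix V V ℂ}
    (hB : ∀ x y z, c x = c y → B x z = B y z) : averagingMatrix c * B = B := by
  classical
  ext x z
  have h : ∀ y, averagingMatrix c x y * B y z = if c y = c x then
      ((Finset.univ.filter fun u => c u = c x).card : ℂ)⁻¹ * B x z else 0 := by
    intro y
    simp only [averagingMatrix, of_apply, eq_comm (a := c x)]
    split_ifs with h
    · rw [hB y x z h]
    · simp
  rw [Matrix.mul_apply, Finset.sum_congr rfl fun y _ => h y, ← Finset.sum_filter,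
    Finset.sum_const, nsmul_eq_mul, mul_inv_cancel_left₀]
  rw [Nat.cast_ne_zero, Finset.card_ne_zero]
  exact ⟨x, by simp⟩

/-- A symmetric matrix that preserves functions constant on colour classes commutes with the
averaging matrix. -/
theorem averagingMatrix_commute {c : V → C} {B : Matrix V V ℂ} (hsymm : Bᵀ = B)
    (hB : ∀ x y z, c x = c y →
      (B * averagingMatrix c) x z = (B * averagingMatrix c) y z) :
    averagingMatrix c * B = B * averagingMatrix c := by
  have h1 : averagingMatrix c * (B * averagingMatrix c) = B * averagingMatrix c :=
    averagingMatrix_mul_of_const hB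
  -- With `M` the averaging matrix, `M B M = B M` transposes to `M B M = M B`.
  have h2 := congrArg transpose h1
  simp only [transpose_mul, averagingMatrix_transpose, hsymm] at h2
  rw [← h2, Matrix.mul_assoc, h1]

theorem averagingMatrix_apply_ite [DecidableEq C] (c : V → C) (y z : V) :
    averagingMatrix c y z =
      if c y = c z then ((Finset.univ.filter fun u => c u = c z).card : ℂ)⁻¹ else 0 := by
  simp only [averagingMatrix, of_apply]
  split_ifs with h
  · rw [h]; congr
  · rfl

/-- The class of `v` is the singleton `{v}`. This keeps a vector with `f v ≠ 0` nonzero after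
averaging. -/
theorem averagingMatrix_mulVec_self (G : SimpleGraph V) (v : V) (f : V → ℂ) :
    (averagingMatrix (indStableColour G v) *ᵥ f) v = f v := by
  classical
  simp only [mulVec, dotProduct, averagingMatrix, of_apply, indStableColour_eq_self_iff,
    eq_comm (b := indStableColour G v v)]
  simp [Finset.filter_eq]

theorem permTransformation_mul_apply {V W : Type u} [Fintype V] (σ : V ≃ W) (B : Matrix V V ℂ) (x z : V) :
    (permTransformation σ * B) (σ x) z = B x z := by
  classical
  simp [permTransformation, Matrix.mul_apply]

theorem permTransformation_mulVec_apply {V W : Type u} [Fintype V] (σ : V ≃ W) (f : V → ℂ) (x : V) :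
    (permTransformation σ *ᵥ f) (σ x) = f x := by
  classical
  simp [permTransformation, mulVec, dotProduct]

theorem mul_permTransformation_apply {V W : Type u} [Fintype W] (σ : V ≃ W) (B : Matrix W W ℂ) (y : W) (z : V) :
    (B * permTransformation σ) y z = B y (σ z) := by
  classical
  simp [permTransformation, Matrix.mul_apply]

open Classical in
theorem adjacencyMap_mul_averagingMatrix_apply (G : SimpleGraph V)
    (c : V → C) (x z : V) :
    (adjacencyMap V G * averagingMatrix c) x z =
      (Finset.univ.filter fun u => G.Adj x u ∧ c u = c z).card *
        ((Finset.univ.filter fun u => c u = c z).card : ℂ)⁻¹ := by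
  simp only [Matrix.mul_apply, adjacencyMap, SimpleGraph.adjMatrix_apply,
    averagingMatrix_apply_ite, ite_mul, one_mul, zero_mul, ← ite_and]
  rw [← Finset.sum_filter, Finset.sum_const, nsmul_eq_mul]

end Matrices

/-! ### Equitable maps: generators and closure properties. -/

section Equitable

open Matrix

/-- Entrywise form of the second equitability condition. -/
theorem permTransformation_intertwines_iff {V W : Type u} [Fintype V] [Fintype W] (σ : V ≃ W)
    (A M : Matrix V V ℂ) (B : Matrix W W ℂ) :
    permTransformation σ * A * M = B * permTransformation σ * M ↔
      ∀ x z, ∑ y, A x y * M y z = ∑ y, B (σ x) (σ y) * M y z := by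
  rw [Matrix.mul_assoc]
  constructor
  · intro h x z
    have := congrFun (congrFun h (σ x)) z
    rw [permTransformation_mul_apply] at this
    simpa only [Matrix.mul_apply (N := M), mul_permTransformation_apply] using this
  · intro h
    ext y z
    obtain ⟨x, rfl⟩ := σ.surjective y
    rw [permTransformation_mul_apply]
    simpa only [Matrix.mul_apply (N := M), mul_permTransformation_apply] using h x z

theorem isEquitable_identityMap : IsEquitable identityMap.{u} := by
  classical
  intro V W _ _ G H π h
  refine ⟨fun v => by simp [identityMap], fun v σ hσ => by simp [identityMap]⟩

theorem isEquitable_onesMap : IsEquitable onesMap.{u} := by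
  classical
  intro V W _ _ G H π h
  refine ⟨fun v => averagingMatrix_commute (by ext; simp [onesMap]) fun x y z _ => ?_,
    fun v σ hσ => (permTransformation_intertwines_iff _ _ _ _).2 fun x z => ?_⟩
  · simp [Matrix.mul_apply, onesMap]
  · simp [onesMap]

theorem isEquitable_degreeMap : IsEquitable degreeMap.{u} := by
  classical
  intro V W _ _ G H π h
  refine ⟨fun v => ?_, fun v σ hσ => (permTransformation_intertwines_iff _ _ _ _).2 fun x z => ?_⟩
  · ext x z
    simp only [degreeMap, SimpleGraph.degMatrix, mul_diagonal, diagonal_mul, averagingMatrix,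
      of_apply]
    split_ifs with hxz
    · rw [degree_eq_of_stableColour_eq hxz, mul_comm]
    · simp
  · refine Finset.sum_congr rfl fun y _ => ?_
    simp only [degreeMap, SimpleGraph.degMatrix, diagonal_apply, σ.apply_eq_iff_eq,
      degree_eq_of_stableColour_eq (hσ x)]

/-- Entries of `A M^v` are numbers of neighbours in a class divided by the class size; both
conditions therefore reduce to `card_adj_stableColour`. -/
theorem isEquitable_adjacencyMap : IsEquitable adjacencyMap.{u} := by
  classical
  intro V W _ _ G H π h
  refine ⟨fun v => averagingMatrix_commute (by simp [adjacencyMap]) fun x y z hxy => ?_,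
    fun v σ hσ => (permTransformation_intertwines_iff _ _ _ _).2 fun x z => ?_⟩
  · simp only [adjacencyMap_mul_averagingMatrix_apply]
    rw [indStableColour, card_adj_stableColour hxy]
  · rw [← Matrix.mul_apply, adjacencyMap_mul_averagingMatrix_apply]
    simp only [adjacencyMap, SimpleGraph.adjMatrix_apply, averagingMatrix_apply_ite, ite_mul,
      one_mul, zero_mul, ← ite_and]
    rw [← Finset.sum_filter, Finset.sum_const, nsmul_eq_mul]
    congr 2
    rw [indStableColour, card_adj_stableColour (hσ x)]
    refine (Finset.card_equiv σ fun y => ?_).symm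
    simp only [Finset.mem_filter, Finset.mem_univ, true_and]
    rw [show stableColour H (individualise (π v)) (σ y) = stableColour G (individualise v) y
      from (hσ y).symm]

variable {φ ψ : MatrixMap.{u}}

theorem IsEquitable.add (hφ : IsEquitable φ) (hψ : IsEquitable ψ) :
    IsEquitable fun V _ G => φ V G + ψ V G := by
  intro V W _ _ G H π h
  obtain ⟨a₁, a₂⟩ := hφ V W G H π h
  obtain ⟨b₁, b₂⟩ := hψ V W G H π h
  refine ⟨fun v => ?_, fun v σ hσ => ?_⟩
  · rw [Matrix.mul_add, Matrix.add_mul, a₁, b₁]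
  · simp only [Matrix.mul_add, Matrix.add_mul, a₂ v σ hσ, b₂ v σ hσ]

theorem IsEquitable.sub (hφ : IsEquitable φ) (hψ : IsEquitable ψ) :
    IsEquitable fun V _ G => φ V G - ψ V G := by
  intro V W _ _ G H π h
  obtain ⟨a₁, a₂⟩ := hφ V W G H π h
  obtain ⟨b₁, b₂⟩ := hψ V W G H π h
  refine ⟨fun v => ?_, fun v σ hσ => ?_⟩
  · rw [Matrix.mul_sub, Matrix.sub_mul, a₁, b₁]
  · simp only [Matrix.mul_sub, Matrix.sub_mul, a₂ v σ hσ, b₂ v σ hσ]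

/-- (E1) for `ψ` slides `M^v` past `ψ(G)`, so that (E2) for `φ` applies; it is then slid back for
(E2) of `ψ`. -/
theorem IsEquitable.mul (hφ : IsEquitable φ) (hψ : IsEquitable ψ) :
    IsEquitable fun V _ G => φ V G * ψ V G := by
  intro V W _ _ G H π h
  obtain ⟨a₁, a₂⟩ := hφ V W G H π h
  obtain ⟨b₁, b₂⟩ := hψ V W G H π h
  refine ⟨fun v => ?_, fun v σ hσ => ?_⟩
  · rw [← Matrix.mul_assoc, a₁, Matrix.mul_assoc, b₁, Matrix.mul_assoc]
  · calc permTransformation σ * (φ V G * ψ V G) * averagingMatrix (indStableColour G v)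
        = permTransformation σ * φ V G * averagingMatrix (indStableColour G v) * ψ V G := by
          simp only [Matrix.mul_assoc, b₁]
      _ = φ W H * (permTransformation σ * ψ V G * averagingMatrix (indStableColour G v)) := by
          rw [a₂ v σ hσ]; simp only [Matrix.mul_assoc, b₁]
      _ = φ W H * ψ W H * permTransformation σ * averagingMatrix (indStableColour G v) := by
          rw [b₂ v σ hσ]; simp only [Matrix.mul_assoc]

theorem IsEquitable.smul_numEdges (hφ : IsEquitable φ) (a : ℕ → ℂ) :
    IsEquitable fun V _ G => a (numEdges G) • φ V G := by
  intro V W _ _ G H π h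
  obtain ⟨a₁, a₂⟩ := hφ V W G H π h
  refine ⟨fun v => ?_, fun v σ hσ => ?_⟩
  · rw [Matrix.mul_smul, Matrix.smul_mul, a₁]
  · simp only [Matrix.mul_smul, Matrix.smul_mul, a₂ v σ hσ, numEdges_eq_of_stableColour_eq σ hσ]

-- For `f` in the kernel with `f v ≠ 0`, the vector `P M^v f` lies in the kernel of `φ(H)` by (E1)
-- and (E2), and its entry at `σ v` is still `f v`.
open Classical in
theorem IsEquitable.det_eq_zero (hφ : IsEquitable φ) {V W : Type u} [Fintype V] [Fintype W]
    {G : SimpleGraph V} {H : SimpleGraph W} {π : V ≃ W} (h : ColourPreserving G H π)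
    (h0 : (φ V G).det = 0) : (φ W H).det = 0 := by
  obtain ⟨f, hf, hφf⟩ := exists_mulVec_eq_zero_iff.2 h0
  obtain ⟨v, hv⟩ := Function.ne_iff.1 hf
  obtain ⟨σ, hσ⟩ := h.exists_equiv v
  obtain ⟨a₁, a₂⟩ := hφ V W G H π h
  refine exists_mulVec_eq_zero_iff.1
    ⟨permTransformation σ *ᵥ (averagingMatrix (indStableColour G v) *ᵥ f), fun h' => hv ?_, ?_⟩
  · have := congrFun h' (σ v)
    rwa [permTransformation_mulVec_apply, averagingMatrix_mulVec_self] at this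
  · rw [mulVec_mulVec, mulVec_mulVec, ← a₂ v σ hσ, Matrix.mul_assoc, ← a₁,
      ← mulVec_mulVec, ← mulVec_mulVec, hφf, mulVec_zero, mulVec_zero]

theorem IsEquitable.inverseMap (hφ : IsEquitable φ) : IsEquitable (inverseMap φ) := by
  classical
  intro V W _ _ G H π h
  have hdet : IsUnit (φ V G).det ↔ IsUnit (φ W H).det := by
    simp only [isUnit_iff_ne_zero]
    exact not_congr ⟨hφ.det_eq_zero h, hφ.det_eq_zero h.symm⟩
  obtain ⟨a₁, a₂⟩ := hφ V W G H π h
  by_cases hu : IsUnit (φ V G).det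
  · have hu' := hdet.1 hu
    have eG : EquitableWL.inverseMap φ V G = (φ V G)⁻¹ := if_pos hu
    have eH : EquitableWL.inverseMap φ W H = (φ W H)⁻¹ := if_pos hu'
    have hcomm : ∀ v, averagingMatrix (indStableColour G v) * (φ V G)⁻¹ =
        (φ V G)⁻¹ * averagingMatrix (indStableColour G v) := fun v => by
      rw [← nonsing_inv_mul_cancel_left (φ V G) (averagingMatrix (indStableColour G v) * _) hu,
        ← Matrix.mul_assoc (φ V G), ← a₁, mul_nonsing_inv_cancel_right _ _ hu]
    refine ⟨fun v => by rw [eG, hcomm], fun v σ hσ => ?_⟩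
    rw [eG, eH, Matrix.mul_assoc, ← hcomm, Matrix.mul_assoc,
      -- Cancelling `φ(H)⁻¹` leaves `φ(H) P M φ(G)⁻¹ = P M`, which is (E2) for `φ` after moving `M`
      -- past `φ(G)`.
      ← nonsing_inv_mul_cancel_left (φ W H) (permTransformation σ * _) hu']
    congr 1
    rw [← Matrix.mul_assoc, ← Matrix.mul_assoc, ← a₂ v σ hσ, Matrix.mul_assoc _ (φ V G), ← a₁,
      ← Matrix.mul_assoc, mul_nonsing_inv_cancel_right _ _ hu]
  · have eG : EquitableWL.inverseMap φ V G = 0 := if_neg hu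
    have eH : EquitableWL.inverseMap φ W H = 0 := if_neg (fun h' => hu (hdet.2 h'))
    rw [eG, eH]
    simp

/-- For edgeless graphs the scalar is `0⁻¹ = 0`, in line with the convention for the last summand.
-/
theorem isEquitable_kBase : IsEquitable kBase.{u} :=
  (isEquitable_identityMap.sub (isEquitable_degreeMap.inverseMap.mul isEquitable_adjacencyMap)).add
    ((isEquitable_onesMap.mul isEquitable_degreeMap).smul_numEdges fun m => (2 * (m : ℂ))⁻¹)

theorem isEquitable_kMap : IsEquitable kMap.{u} :=
  isEquitable_kBase.inverseMap.mul
    ((isEquitable_degreeMap.inverseMap.smul_numEdges fun m => 2 * (m : ℂ)).sub isEquitable_onesMap)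

end Equitable

end EquitableWL

theorem mainTheorem8 :
    EquitableWL.IsEquitable EquitableWL.kMap.{u} ∧
    ∀ (V : Type u) [Fintype V] [DecidableEq V] [MeasurableSpace V] [DiscreteMeasurableSpace V]
      (G : SimpleGraph V), G.Connected → ∀ s t : V,
        EquitableWL.commuteDistance G s t ≠ ⊤ ∧
        ((EquitableWL.commuteDistance G s t).toReal : ℂ) =
          (Pi.single s 1 - Pi.single t 1 : V → ℂ) ⬝ᵥ
            (Matrix.mulVec (EquitableWL.kMap V G) (Pi.single s 1 - Pi.single t 1)) :=
  ⟨EquitableWL.isEquitable_kMap, fun _ _ _ _ _ _ hG s t =>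
    ⟨EquitableWL.commuteDistance_ne_top hG s t, EquitableWL.commuteDistance_eq hG s t⟩⟩
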